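/- Let $U$ be a finite set with $n := |U| \ge 2$, and write $\bar X := U \setminus X$. Let $\kappa : 2^U \to \mathbb{Z}$ be a connectivity function on $U$, that is, $\kappa(\emptyset) = 0$, and $\kappa(X) = \kappa(\bar X)$ and $\kappa(X) + \kappa(Y) \ge \kappa(X \cap Y) + \kappa(X \cup Y)$ for all $X, Y \subseteq U$. A $\kappa$-tangle of order $k$ (an integer $k \ge 0$) is a family $\mathcal{T} \subseteq 2^U$ such that $\kappa(X) < k$ for all $X \in \mathcal{T}$; for every $X \subseteq U$ with $\kappa(X) < k$, either $X \in \mathcal{T}$ or $\bar X \in \mathcal{T}$; $X_1 \cap X_2 \cap X_3 \ne \emptyset$ for all $X_1, X_2, X_3 \in \mathcal{T}$; and $\{x\} \notin \mathcal{T}$ for all $x \in U$. Formally a tangle is the pair $(\mathcal{T}, k)$. A tangle $(\mathcal{T}, k)$ is an extension of $(\mathcal{T}', k')$ if $\mathcal{T}' \subseteq \mathcal{T}$ and $k' \le k$, and a tangle is maximal if it has no extension other than itself. Then there are at most $n - 1$ maximal $\kappa$-tangles. -/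

import Mathlib

/-- A connectivity function on `U`: a normalised, symmetric, submodular integer-valued
function on the subsets of `U`. -/
structure ConnectivityFunction (U : Type*) where
  toFun : Set U → ℤ
  normalised : toFun ∅ = 0
  symmetric : ∀ X : Set U, toFun X = toFun Xᶜ
  submodular : ∀ X Y : Set U, toFun (X ∩ Y) + toFun (X ∪ Y) ≤ toFun X + toFun Y

instance {U : Type*} : CoeFun (ConnectivityFunction U) (fun _ => Set U → ℤ) where
  coe κ := κ.toFun

/-- A `κ`-tangle, recorded together with its order: two tangles of different orders are
distinct even if they contain the same sets. -/
@[ext]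
structure Tangle {U : Type*} (κ : ConnectivityFunction U) where
  sets : Set (Set U)
  order : ℕ
  lt_order : ∀ X ∈ sets, κ X < (order : ℤ)
  mem_or_compl_mem : ∀ X : Set U, κ X < (order : ℤ) → X ∈ sets ∨ Xᶜ ∈ sets
  inter_nonempty : ∀ X₁ ∈ sets, ∀ X₂ ∈ sets, ∀ X₃ ∈ sets, (X₁ ∩ X₂ ∩ X₃).Nonempty
  singleton_notMem : ∀ x : U, ({x} : Set U) ∉ sets

namespace Tangle

variable {U : Type*} {κ : ConnectivityFunction U}

/-- `T` is an extension of `T'`. The condition on orders only matters when `T` and `T'`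
contain the same sets. -/
def IsExtensionOf (T T' : Tangle κ) : Prop :=
  T'.sets ⊆ T.sets ∧ T'.order ≤ T.order

/-- A tangle is maximal if it has no proper extension. -/
def IsMaximal (T : Tangle κ) : Prop :=
  ∀ T' : Tangle κ, T'.IsExtensionOf T → T' = T

end Tangle

/-! Distinct maximal tangles are pairwise distinguishable, so it suffices that a finite pairwise
distinguishable family has fewer than `n` members. Induct on its size. Choose `X` inclusion-minimal
among the sets that efficiently distinguish some pair; uncrossing shows that `X` lies in exactly one
tangle and that the others can be told apart by sets that do not split `X`
(`exists_mem_and_forall_distinguishes`). Drop that tangle and contract `X` to a point: the others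
survive, and as `|X| ≥ 2` a point is lost. -/

namespace ConnectivityFunction

/-- The connectivity function that `κ` induces along a map `f`. -/
def comap {U V : Type*} (κ : ConnectivityFunction U) (f : U → V) : ConnectivityFunction V where
  toFun Y := κ (f ⁻¹' Y)
  normalised := κ.normalised
  symmetric Y := κ.symmetric (f ⁻¹' Y)
  submodular Y Z := κ.submodular (f ⁻¹' Y) (f ⁻¹' Z)

end ConnectivityFunction

namespace Tangle

universe u

section

variable {U : Type*} {κ : ConnectivityFunction U}

/-- The tangle that `T` induces along a map none of whose fibres belongs to `T`. -/
def comap {V : Type*} (T : Tangle κ) (f : U → V) (hf : ∀ v, f ⁻¹' {v} ∉ T.sets) :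
    Tangle (κ.comap f) where
  sets := {Y | f ⁻¹' Y ∈ T.sets}
  order := T.order
  lt_order Y hY := T.lt_order _ hY
  mem_or_compl_mem Y hY := T.mem_or_compl_mem (f ⁻¹' Y) hY
  inter_nonempty X₁ h₁ X₂ h₂ X₃ h₃ := by
    obtain ⟨u, hu⟩ := T.inter_nonempty _ h₁ _ h₂ _ h₃
    exact ⟨f u, hu⟩
  singleton_notMem := hf

theorem mem_of_inter_subset (T : Tangle κ) {A B Y : Set U} (hA : A ∈ T.sets) (hB : B ∈ T.sets)
    (h : A ∩ B ⊆ Y) (hY : κ Y < T.order) : Y ∈ T.sets := by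
  refine (T.mem_or_compl_mem Y hY).resolve_right fun hc => ?_
  obtain ⟨u, hu, hu'⟩ := T.inter_nonempty A hA B hB _ hc
  exact hu' (h hu)

theorem mem_of_subset (T : Tangle κ) {A Y : Set U} (hA : A ∈ T.sets)
    (h : A ⊆ Y) (hY : κ Y < T.order) : Y ∈ T.sets :=
  T.mem_of_inter_subset hA hA (Set.inter_subset_left.trans h) hY

theorem false_of_inter_eq_empty (T : Tangle κ) {A B C : Set U} (hA : A ∈ T.sets)
    (hB : B ∈ T.sets) (hC : C ∈ T.sets) (h : A ∩ B ∩ C = ∅) : False :=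
  (T.inter_nonempty A hA B hB C hC).ne_empty h

/-- `Y` separates `T₁` from `T₂`, with `T₁` living in `Y`. -/
def Distinguishes (Y : Set U) (T₁ T₂ : Tangle κ) : Prop :=
  Y ∈ T₁.sets ∧ Yᶜ ∈ T₂.sets

theorem Distinguishes.symm {Y : Set U} {T₁ T₂ : Tangle κ} (h : Distinguishes Y T₁ T₂) :
    Distinguishes Yᶜ T₂ T₁ :=
  ⟨h.2, (compl_compl Y).symm ▸ h.1⟩

/-- `Y` separates `T₁` from `T₂` and has minimum connectivity among the sets that do. -/
def EfficientlyDistinguishes (Y : Set U) (T₁ T₂ : Tangle κ) : Prop :=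
  Distinguishes Y T₁ T₂ ∧ ∀ Z, Distinguishes Z T₁ T₂ → κ Y ≤ κ Z

theorem EfficientlyDistinguishes.symm {Y : Set U} {T₁ T₂ : Tangle κ}
    (h : EfficientlyDistinguishes Y T₁ T₂) : EfficientlyDistinguishes Yᶜ T₂ T₁ := by
  refine ⟨h.1.symm, fun Z hZ => ?_⟩
  rw [← κ.symmetric Y, κ.symmetric Z]
  exact h.2 _ hZ.symm

theorem EfficientlyDistinguishes.of_le {Y Z : Set U} {T₁ T₂ : Tangle κ}
    (h : EfficientlyDistinguishes Y T₁ T₂) (hZ : Distinguishes Z T₁ T₂) (hle : κ Z ≤ κ Y) :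
    EfficientlyDistinguishes Z T₁ T₂ :=
  ⟨hZ, fun W hW => hle.trans (h.2 W hW)⟩

theorem distinguishes_of_inter_subset {T₁ T₂ : Tangle κ} {A B C D Z : Set U}
    (hA : A ∈ T₁.sets) (hB : B ∈ T₁.sets) (hC : C ∈ T₂.sets) (hD : D ∈ T₂.sets)
    (h₁ : A ∩ B ⊆ Z) (h₂ : C ∩ D ⊆ Zᶜ) (hZ₁ : κ Z < T₁.order) (hZ₂ : κ Z < T₂.order) :
    Distinguishes Z T₁ T₂ :=
  ⟨T₁.mem_of_inter_subset hA hB h₁ hZ₁, T₂.mem_of_inter_subset hC hD h₂ (κ.symmetric Z ▸ hZ₂)⟩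

theorem exists_efficientlyDistinguishes [Finite U] {T₁ T₂ : Tangle κ} {Y : Set U}
    (h : Distinguishes Y T₁ T₂) : ∃ Z, EfficientlyDistinguishes Z T₁ T₂ := by
  obtain ⟨Z, hZ, hmin⟩ := Set.exists_min_image {Z | Distinguishes Z T₁ T₂} (fun Z => κ Z)
    (Set.toFinite _) ⟨Y, h⟩
  exact ⟨Z, hZ, hmin⟩

theorem Distinguishes.lt_order_right {Y : Set U} {T₁ T₂ : Tangle κ}
    (h : Distinguishes Y T₁ T₂) : κ Y < T₂.order :=
  κ.symmetric Y ▸ T₂.lt_order _ h.2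

theorem submodular_compl_right (κ : ConnectivityFunction U) (X Y : Set U) :
    κ (X ∩ Yᶜ) + κ (X ∪ Yᶜ) ≤ κ X + κ Y :=
  κ.symmetric Y ▸ κ.submodular X Yᶜ

/-- If `X` is efficient for `T, T'` and also belongs to `T₁`, then some proper subset of `X`
efficiently distinguishes two of the three tangles. -/
theorem exists_ssubset_efficientlyDistinguishes {T T' T₁ : Tangle κ} {X Y : Set U}
    (hX : EfficientlyDistinguishes X T T') (hX₁ : X ∈ T₁.sets)
    (hY : EfficientlyDistinguishes Y T T₁) :
    ∃ Z, Z ⊂ X ∧ (EfficientlyDistinguishes Z T T' ∨ EfficientlyDistinguishes Z T₁ T' ∨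
      EfficientlyDistinguishes Z T T₁ ∨ EfficientlyDistinguishes Z T₁ T) := by
  obtain ⟨⟨hXT, hXT'⟩, hXmin⟩ := id hX
  obtain ⟨⟨hYT, hYT₁⟩, hYmin⟩ := id hY
  have oXT := T.lt_order _ hXT
  have oXT' := hX.1.lt_order_right
  have oXT₁ := T₁.lt_order _ hX₁
  have oYT := T.lt_order _ hYT
  have oYT₁ := hY.1.lt_order_right
  have sub₁ := κ.submodular X Y
  have sub₂ := submodular_compl_right κ X Y
  have ss₁ : X ∩ Y ⊂ X := by
    refine Set.inter_subset_left.ssubset_of_ne fun h => ?_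
    exact T₁.false_of_inter_eq_empty hX₁ hX₁ hYT₁ (by grind)
  have ss₂ : X ∩ Yᶜ ⊂ X := by
    refine Set.inter_subset_left.ssubset_of_ne fun h => ?_
    exact T.false_of_inter_eq_empty hXT hXT hYT (by grind)
  rcases le_or_gt (κ Y) (κ X) with hle | hlt
  · rcases T'.mem_or_compl_mem Y (hle.trans_lt oXT') with hYT' | hYT'
    · have h₁ : κ X ≤ κ (X ∪ Yᶜ) := by
        by_contra! hlt
        exact hlt.not_ge (hXmin _ (distinguishes_of_inter_subset hXT hXT hXT' hYT'
          (by grind) (by grind) (by lia) (by lia)))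
      have h₂ : Distinguishes (X ∩ Yᶜ) T₁ T' :=
        distinguishes_of_inter_subset hX₁ hYT₁ hXT' hXT' (by grind) (by grind) (by lia) (by lia)
      refine ⟨_, ss₂, Or.inr (Or.inl ⟨h₂, fun W hW => ?_⟩)⟩
      by_contra! hWlt
      -- `h₁` and submodularity give `κ W < κ Y ≤ κ X`, so `T` orients `W`; either choice beats `X`
      -- or `Y`.
      have oWT : κ W < T.order := by lia
      rcases T.mem_or_compl_mem W oWT with hWT | hWT
      · have := hXmin W ⟨hWT, hW.2⟩
        lia
      · have := hYmin Wᶜ ⟨hWT, (compl_compl W).symm ▸ hW.1⟩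
        rw [← κ.symmetric] at this
        lia
    · have h₁ : κ X ≤ κ (X ∪ Y) := by
        by_contra! hlt
        exact hlt.not_ge (hXmin _ (distinguishes_of_inter_subset hXT hXT hXT' hYT'
          (by grind) (by grind) (by lia) (by lia)))
      refine ⟨_, ss₁, Or.inl (hX.of_le (distinguishes_of_inter_subset hXT hYT hXT' hXT'
        (by grind) (by grind) (by lia) (by lia)) (by lia))⟩
  · by_cases h₁ : κ (X ∩ Y) ≤ κ Y
    · exact ⟨_, ss₁, Or.inr (Or.inr (Or.inl (hY.of_le (distinguishes_of_inter_subset hXT hYT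
        hYT₁ hYT₁ (by grind) (by grind) (by lia) (by lia)) h₁)))⟩
    by_cases h₂ : κ (X ∩ Yᶜ) ≤ κ Y
    · refine ⟨_, ss₂, Or.inr (Or.inr (Or.inr (hY.symm.of_le (distinguishes_of_inter_subset hX₁
        hYT₁ hYT hYT (by grind) (by grind) (by lia) (by lia)) ?_)))⟩
      rwa [← κ.symmetric Y]
    -- Both intersections exceed `κ Y`, so both unions fall below `κ X`; efficiency of `X` forces
    -- them into `T'`, where they meet `Xᶜ` in the empty set.
    have key : ∀ W, X ⊆ W → κ W < κ X → W ∈ T'.sets := fun W hW hlt => by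
      refine (T'.mem_or_compl_mem W (hlt.trans oXT')).resolve_right fun hc => ?_
      exact hlt.not_ge (hXmin W ⟨T.mem_of_subset hXT hW (hlt.trans oXT), hc⟩)
    exact (T'.false_of_inter_eq_empty (key (X ∪ Y) Set.subset_union_left (by lia))
      (key (X ∪ Yᶜ) Set.subset_union_left (by lia)) hXT' (by grind)).elim

/-- As `κ Y < κ X`, both `T` and `T'` contain `Y`. So `X ∩ Y` and `X ∪ Yᶜ` have connectivity at
least `κ X`, and the opposite corners `X ∪ Y` and `X ∩ Yᶜ` at most `κ Y`. -/
theorem distinguishes_union_of_lt {T T' T₁ T₂ : Tangle κ} {X Y : Set U}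
    (hX : EfficientlyDistinguishes X T T') (hY : Distinguishes Y T₁ T₂)
    (hmin : ∀ Z, Z ⊆ X → κ Z ≤ κ Y → ¬ Distinguishes Z T₂ T₁)
    (hlt : κ Y < κ X) (hYT : Y ∈ T.sets) :
    Distinguishes (X ∪ Y) T₁ T₂ := by
  obtain ⟨⟨hXT, hXT'⟩, hXmin⟩ := id hX
  have oXT := T.lt_order _ hXT
  have oXT' := hX.1.lt_order_right
  have oY₁ := T₁.lt_order _ hY.1
  have oY₂ := hY.lt_order_right
  have hYT' : Y ∈ T'.sets := by
    refine (T'.mem_or_compl_mem Y (hlt.trans oXT')).resolve_right fun hc => ?_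
    exact hlt.not_ge (hXmin Y ⟨hYT, hc⟩)
  have sub₁ := κ.submodular X Y
  have sub₂ := submodular_compl_right κ X Y
  have h₁ : κ X ≤ κ (X ∩ Y) := by
    by_contra! hlt
    exact hlt.not_ge (hXmin _ (distinguishes_of_inter_subset hXT hYT hXT' hXT'
      (by grind) (by grind) (by lia) (by lia)))
  have h₂ : κ X ≤ κ (X ∪ Yᶜ) := by
    by_contra! hlt
    exact hlt.not_ge (hXmin _ (distinguishes_of_inter_subset hXT hXT hXT' hYT'
      (by grind) (by grind) (by lia) (by lia)))
  refine ⟨T₁.mem_of_subset hY.1 (by grind) (by lia), ?_⟩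
  refine (T₂.mem_or_compl_mem (X ∪ Y) (by lia)).resolve_left fun hc => ?_
  rcases T₂.mem_or_compl_mem (X ∩ Yᶜ) (by lia) with h | h
  · refine hmin _ Set.inter_subset_left (by lia) ⟨h, T₁.mem_of_subset hY.1 (by grind) ?_⟩
    rw [← κ.symmetric]
    lia
  · exact T₂.false_of_inter_eq_empty hc h hY.2 (by grind)

/-- If both uncrossings cost more than `κ Y`, then `X ∩ Y` and `X ∩ Yᶜ` fall below `κ X`, so `T`
contains their complements; these and `X` have empty intersection. -/
theorem exists_distinguishes_of_le {T T' T₁ T₂ : Tangle κ} {X Y : Set U}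
    (hX : EfficientlyDistinguishes X T T') (hY : Distinguishes Y T₁ T₂)
    (h₁ : X ∉ T₁.sets) (h₂ : X ∉ T₂.sets) (hle : κ X ≤ κ Y) :
    ∃ Z, (X ⊆ Z ∨ Disjoint X Z) ∧ Distinguishes Z T₁ T₂ := by
  obtain ⟨⟨hXT, hXT'⟩, hXmin⟩ := id hX
  have oXT := T.lt_order _ hXT
  have oXT' := hX.1.lt_order_right
  have oY₁ := T₁.lt_order _ hY.1
  have oY₂ := hY.lt_order_right
  have hX₁ := (T₁.mem_or_compl_mem X (by lia)).resolve_left h₁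
  have hX₂ := (T₂.mem_or_compl_mem X (by lia)).resolve_left h₂
  have sub₁ := κ.submodular X Y
  have sub₂ := submodular_compl_right κ X Y
  have sym : κ (Xᶜ ∩ Y) = κ (X ∪ Yᶜ) := by
    rw [κ.symmetric (X ∪ Yᶜ), Set.compl_union, compl_compl]
  by_cases c₁ : κ (X ∪ Y) ≤ κ Y
  · exact ⟨X ∪ Y, Or.inl Set.subset_union_left, distinguishes_of_inter_subset hY.1 hY.1 hX₂ hY.2
      (by grind) (by grind) (by lia) (by lia)⟩
  by_cases c₂ : κ (X ∪ Yᶜ) ≤ κ Y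
  · exact ⟨Xᶜ ∩ Y, Or.inr (Set.disjoint_left.2 (by grind)), distinguishes_of_inter_subset hX₁ hY.1
      hY.2 hY.2 (by grind) (by grind) (by lia) (by lia)⟩
  have key : ∀ W, W ⊆ X → κ W < κ X → Wᶜ ∈ T.sets := fun W hW hlt => by
    refine (T.mem_or_compl_mem W (hlt.trans oXT)).resolve_left fun hc => ?_
    refine hlt.not_ge (hXmin W ⟨hc, T'.mem_of_subset hXT' (Set.compl_subset_compl.2 hW) ?_⟩)
    rw [← κ.symmetric]
    lia
  exact (T.false_of_inter_eq_empty hXT (key (X ∩ Y) Set.inter_subset_left (by lia))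
    (key (X ∩ Yᶜ) Set.inter_subset_left (by lia)) (by grind)).elim

/-- In a finite family of at least two pairwise distinguishable tangles, some set belongs to
exactly one of them, and the others can be distinguished without crossing it. -/
theorem exists_mem_and_forall_distinguishes [Finite U] {ι : Type*} [Nontrivial ι]
    (T : ι → Tangle κ) (hT : ∀ i j, i ≠ j → ∃ Y, Distinguishes Y (T i) (T j)) :
    ∃ i X, X ∈ (T i).sets ∧ (∀ j, j ≠ i → X ∉ (T j).sets) ∧ Xᶜ.Nonempty ∧
      ∀ j k, j ≠ i → k ≠ i → j ≠ k →
        ∃ Y, (X ⊆ Y ∨ Disjoint X Y) ∧ Distinguishes Y (T j) (T k) := by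
  have hE : ∀ i j, i ≠ j → ∃ Y, EfficientlyDistinguishes Y (T i) (T j) := fun i j hij =>
    (hT i j hij).elim fun _ => exists_efficientlyDistinguishes
  obtain ⟨a, b, hab⟩ := exists_pair_ne ι
  obtain ⟨X, ⟨i, i', hX⟩, hXmin⟩ := Set.Finite.exists_minimal
    (s := {X : Set U | ∃ i j, EfficientlyDistinguishes X (T i) (T j)}) (Set.toFinite _)
    ((hE a b hab).imp fun _ h => ⟨a, b, h⟩)
  have hmin : ∀ Z j k, EfficientlyDistinguishes Z (T j) (T k) → Z ⊆ X → X ⊆ Z :=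
    fun Z j k hZ hZX => hXmin ⟨j, k, hZ⟩ hZX
  have hleaf : ∀ j, j ≠ i → X ∉ (T j).sets := fun j hj hXj => by
    obtain ⟨Y, hY⟩ := hE i j hj.symm
    obtain ⟨Z, hZ, h | h | h | h⟩ := exists_ssubset_efficientlyDistinguishes hX hXj hY
    all_goals exact hZ.2 (hmin Z _ _ h hZ.1)
  refine ⟨i, X, hX.1.1, hleaf, ?_, fun j k hj hk hjk => ?_⟩
  · simpa using (T i').inter_nonempty _ hX.1.2 _ hX.1.2 _ hX.1.2
  obtain ⟨Y, hY⟩ := hE j k hjk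
  rcases le_or_gt (κ X) (κ Y) with hle | hlt
  · exact exists_distinguishes_of_le hX hY.1 (hleaf j hj) (hleaf k hk) hle
  have small : ∀ j k, j ≠ i → ∀ Y, EfficientlyDistinguishes Y (T j) (T k) →
      ∀ Z, Z ⊆ X → κ Z ≤ κ Y → ¬ Distinguishes Z (T j) (T k) := fun j k hj Y hY Z hZX hle hZ => by
    have h := hmin Z j k (hY.of_le hZ hle) hZX
    exact hleaf j hj (hZX.antisymm h ▸ hZ.1)
  rcases (T i).mem_or_compl_mem Y (hlt.trans ((T i).lt_order _ hX.1.1)) with h | h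
  · refine ⟨X ∪ Y, Or.inl Set.subset_union_left, distinguishes_union_of_lt
      hX hY.1 (fun Z hZX hle => ?_) hlt h⟩
    exact small k j hk _ hY.symm Z hZX (κ.symmetric Y ▸ hle)
  · have hd := distinguishes_union_of_lt hX hY.1.symm
      (fun Z hZX hle => small j k hj _ hY Z hZX (κ.symmetric Y ▸ hle)) (κ.symmetric Y ▸ hlt) h
    exact ⟨_, Or.inr (Set.disjoint_left.2 (by grind)), hd.symm⟩

theorem nontrivial_of_mem (T : Tangle κ) {X : Set U} (hX : X ∈ T.sets) : X.Nontrivial := by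
  have hne : X.Nonempty := by simpa using T.inter_nonempty X hX X hX X hX
  refine hne.exists_eq_singleton_or_nontrivial.resolve_left ?_
  rintro ⟨x, rfl⟩
  exact T.singleton_notMem x hX

theorem eq_of_forall_not_distinguishes {T T' : Tangle κ} (hT : T.IsMaximal) (hT' : T'.IsMaximal)
    (h : ∀ Y, ¬ Distinguishes Y T T') : T = T' := by
  rcases le_total T.order T'.order with hle | hle
  · refine (hT T' ⟨fun Y hY => ?_, hle⟩).symm
    have := T.lt_order _ hY
    exact (T'.mem_or_compl_mem Y (by lia)).resolve_right fun hc => h Y ⟨hY, hc⟩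
  · refine hT' T ⟨fun Y hY => ?_, hle⟩
    have := T'.lt_order _ hY
    exact (T.mem_or_compl_mem Y (by lia)).resolve_right fun hc =>
      h Yᶜ ⟨hc, (compl_compl Y).symm ▸ hY⟩

end

/-! ### Contraction and the induction -/

open Classical in
/-- The map that contracts `X` to a single point. -/
noncomputable def contract {U : Type*} (X : Set U) (u : U) : Option (Xᶜ : Set U) :=
  if h : u ∈ X then none else some ⟨u, h⟩

theorem contract_eq_none {U : Type*} {X : Set U} {u : U} : contract X u = none ↔ u ∈ X := by
  unfold contract
  split <;> simp_all

theorem contract_eq_some {U : Type*} {X : Set U} {u : U} {v : (Xᶜ : Set U)} :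
    contract X u = some v ↔ u = v := by
  unfold contract
  split
  · rename_i h
    simp only [reduceCtorEq, false_iff]
    rintro rfl
    exact v.2 h
  · simp [Subtype.ext_iff]

theorem exists_preimage_contract_eq {U : Type*} {X Y : Set U} (h : X ⊆ Y ∨ Disjoint X Y) :
    ∃ Z, contract X ⁻¹' Z = Y := by
  refine ⟨contract X '' Y, Set.Subset.antisymm ?_ (Set.subset_preimage_image _ _)⟩
  rintro u ⟨y, hy, hyu⟩
  by_cases hu : u ∈ X
  · rw [contract_eq_none.2 hu, contract_eq_none] at hyu
    exact h.elim (fun h => h hu) fun h => (Set.disjoint_left.1 h hyu hy).elim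
  · rw [contract_eq_some (v := ⟨u, hu⟩) |>.2 rfl, contract_eq_some] at hyu
    exact (show y = u from hyu) ▸ hy

theorem preimage_contract_singleton_notMem {U : Type*} {κ : ConnectivityFunction U}
    (T : Tangle κ) {X : Set U} (hX : X ∉ T.sets) (v : Option (Xᶜ : Set U)) :
    contract X ⁻¹' {v} ∉ T.sets := by
  cases v with
  | none =>
    convert hX using 2
    ext u
    exact contract_eq_none
  | some v =>
    convert T.singleton_notMem v using 2
    ext u
    exact contract_eq_some

theorem card_lt_of_pairwise_distinguishable (m : ℕ) : ∀ {U : Type u} [Finite U]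
    (κ : ConnectivityFunction U) {ι : Type} [Finite ι] (T : ι → Tangle κ),
    (∀ i j, i ≠ j → ∃ Y, Distinguishes Y (T i) (T j)) → 2 ≤ Nat.card U → Nat.card ι = m →
    m < Nat.card U := by
  induction m with
  | zero => intros; lia
  | succ m ih =>
    intro U _ κ ι _ T hT hU hm
    rcases Nat.eq_zero_or_pos m with rfl | hpos
    · lia
    have : Nontrivial ι := Finite.one_lt_card_iff_nontrivial.1 (by lia)
    obtain ⟨i, X, hXi, hX, hne, hd⟩ := exists_mem_and_forall_distinguishes T hT
    have hsum : X.ncard + Nat.card (Xᶜ : Set U) = Nat.card U := Set.ncard_add_ncard_compl X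
    have hX2 : 1 < X.ncard := (Set.one_lt_ncard_iff_nontrivial).2 ((T i).nontrivial_of_mem hXi)
    have hc : 0 < Nat.card (Xᶜ : Set U) := (Set.ncard_pos (Set.toFinite _)).2 hne
    have hO : Nat.card (Option (Xᶜ : Set U)) = Nat.card (Xᶜ : Set U) + 1 := Finite.card_option
    have hι : Nat.card {j // j ≠ i} = m := by
      have h := Set.ncard_add_ncard_compl ({i} : Set ι)
      rw [Set.ncard_singleton, hm] at h
      change ({i}ᶜ : Set ι).ncard = m
      lia
    have := ih (κ.comap (contract X)) (fun j : {j // j ≠ i} => (T j).comap (contract X)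
      (preimage_contract_singleton_notMem _ (hX j j.2))) (fun j k hjk => by
        obtain ⟨Y, hY, hYd⟩ := hd j k j.2 k.2 (Subtype.coe_injective.ne hjk)
        obtain ⟨Z, rfl⟩ := exists_preimage_contract_eq hY
        exact ⟨Z, hYd⟩) (by lia) hι
    lia

end Tangle

theorem mainTheorem10 {U : Type*} [Finite U] (κ : ConnectivityFunction U)
    (hU : 2 ≤ Nat.card U) :
    {T : Tangle κ | T.IsMaximal}.Finite ∧
      {T : Tangle κ | T.IsMaximal}.ncard ≤ Nat.card U - 1 := by
  have key : ∀ m, ∀ f : Fin m ↪ {T : Tangle κ | T.IsMaximal}, m < Nat.card U := fun m f => by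
    refine Tangle.card_lt_of_pairwise_distinguishable m κ (fun i => (f i).1) (fun i j hij => ?_)
      hU (Nat.card_fin m)
    by_contra! h
    exact hij (f.injective (Subtype.ext
      (Tangle.eq_of_forall_not_distinguishes (f i).2 (f j).2 h)))
  have hfin : {T : Tangle κ | T.IsMaximal}.Finite := by
    by_contra hinf
    have := Set.infinite_coe_iff.2 hinf
    -- The size unifies with `Nat.card U`, giving `Nat.card U < Nat.card U`.
    exact (key _ (Fin.valEmbedding.trans (Infinite.natEmbedding _))).false
  refine ⟨hfin, ?_⟩
  have := hfin.to_subtype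
  have := key _ (Finite.equivFin {T : Tangle κ | T.IsMaximal}).symm.toEmbedding
  exact Nat.le_sub_one_of_lt this
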